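/- Let $\mathcal H$ be an infinite-dimensional real or complex Hilbert space and $A:\mathcal H\to\mathcal H$ a bounded Hermitian (self-adjoint) operator. For a closed subspace $\mathcal U$ let $P_{\mathcal U}$ be the orthogonal projector onto $\mathcal U$ and $(P_{\mathcal U}A)|_{\mathcal U}$ the compression of $A$ to $\mathcal U$; if $\mathcal U$ is finite-dimensional, let $\Lambda((P_{\mathcal U}A)|_{\mathcal U})$ be the vector of its eigenvalues, repeated according to multiplicity, in decreasing order. Let $\mathcal X\neq\{0\}$ and $\mathcal Y$ be finite-dimensional subspaces with $p=\dim\mathcal X\le\dim\mathcal Y<\infty$. Assume that $\mathcal X$ is $A$-invariant and corresponds to the top part of the spectrum of $A$, i.e. every point of the spectrum of $(P_{\mathcal X}A)|_{\mathcal X}$ is an upper bound for the spectrum of $(P_{\mathcal X^\perp}A)|_{\mathcal X^\perp}$. Write $\lambda_1\ge\dots\ge\lambda_p$ for the components of $\Lambda((P_{\mathcal X}A)|_{\mathcal X})$, $\mu_1\ge\dots\ge\mu_p$ for the $p$ largest components of $\Lambda((P_{\mathcal Y}A)|_{\mathcal Y})$, and $\lambda_{\min}$ for the smallest eigenvalue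 of $(P_{\mathcal X+\mathcal Y}A)|_{\mathcal X+\mathcal Y}$. Let $\pi/2\ge\theta_1\ge\dots\ge\theta_p\ge0$ be the principal angles from $\mathcal X$ to $\mathcal Y$: the numbers $\cos^2\theta_1\le\dots\le\cos^2\theta_p$ are the eigenvalues of $(P_{\mathcal X}P_{\mathcal Y})|_{\mathcal X}$, counted with multiplicity. For $x,y\in\mathbb R^p$ write $x\prec_w y$ if for every $k=1,\dots,p$ the sum of the $k$ largest components of $x$ is at most the sum of the $k$ largest components of $y$. Then: 1. $\lambda_i-\mu_i\ge0$ for all $i$, and $\bigl(\lambda_i-\mu_i\bigr)_{i=1}^p\prec_w\bigl((\lambda_i-\lambda_{\min})\sin^2\theta_i\bigr)_{i=1}^p$. 2. $0\le\lambda_i-\mu_i\le(\lambda_i-\lambda_{\min})\max_{1\le j\le p}\sin^2\theta_j$ for all $i$. 3. If $\theta_i<\pi/2$ and $\lambda_i>\lambda_{\min}$ for all $i$, then $\mu_i>\lambda_{\min}$ for all $i$, $$0\le\log\frac{\lambda_i-\lambda_{\min}}{\mu_i-\lambda_{\min}}\ \text{ for all } i,\qquad \Bigl(\log\frac{\lambda_i-\lambda_{\min}}{\mu_i-\lambda_{\min}}\Bigr)_{i=1}^p\prec_w\bigl(\log(1+\tan^2\theta_i)\bigr)_{i=1}^p,$$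 and $$0\le\frac{\lambda_i-\mu_i}{\mu_i-\lambda_{\min}}\ \text{ for all } i,\qquad \Bigl(\frac{\lambda_i-\mu_i}{\mu_i-\lambda_{\min}}\Bigr)_{i=1}^p\prec_w\bigl(\tan^2\theta_i\bigr)_{i=1}^p.$$ -/

import Mathlib

noncomputable section

namespace RayleighRitz

/-- The decreasing rearrangement of a real vector. -/
def decreasing {n : ℕ} (x : Fin n → ℝ) : Fin n → ℝ :=
  fun i => x (Tuple.sort x (Fin.rev i))

/-- Weak (sub-)majorization `x ≺_w y`: for every `k ≤ n`, the sum of the `k` largest entries of `x`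
is at most the sum of the `k` largest entries of `y`. -/
def WeakMajorizedBy {n : ℕ} (x y : Fin n → ℝ) : Prop :=
  ∀ k : ℕ, k ≤ n →
    ∑ i ∈ Finset.univ.filter (fun i : Fin n => i.val < k), decreasing x i ≤
      ∑ i ∈ Finset.univ.filter (fun i : Fin n => i.val < k), decreasing y i

variable {𝕜 : Type*} [RCLike 𝕜] {H : Type*} [NormedAddCommGroup H] [InnerProductSpace 𝕜 H]

/-- The Rayleigh–Ritz operator `(P_U A)|_U`, as an operator on `U`. -/
def compression (A : H →L[𝕜] H) (U : Submodule 𝕜 H) [U.HasOrthogonalProjection] : U →L[𝕜] U :=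
  U.orthogonalProjectionOnto ∘L A ∘L U.subtypeL

theorem compression_isSymmetric [CompleteSpace H] {A : H →L[𝕜] H} (hA : IsSelfAdjoint A)
    (U : Submodule 𝕜 H) [U.HasOrthogonalProjection] :
    (compression A U : U →ₗ[𝕜] U).IsSymmetric := by
  intro x y
  simpa [compression] using hA.isSymmetric (x : H) (y : H)

/-- The vector of Ritz values `Λ((P_U A)|_U)`: the eigenvalues of the Rayleigh–Ritz operator,
repeated according to multiplicity and listed in decreasing order. -/
def ritzValues [CompleteSpace H] {A : H →L[𝕜] H} (hA : IsSelfAdjoint A)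
    (U : Submodule 𝕜 H) [FiniteDimensional 𝕜 U] : Fin (Module.finrank 𝕜 U) → ℝ :=
  (compression_isSymmetric hA U).eigenvalues rfl

/-- The smallest Ritz value of `A` on a nonzero finite dimensional subspace `U`. -/
def minRitzValue [CompleteSpace H] {A : H →L[𝕜] H} (hA : IsSelfAdjoint A)
    (U : Submodule 𝕜 H) [FiniteDimensional 𝕜 U] : ℝ :=
  ⨅ i, ritzValues hA U i

/-- The vector of principal angles from `X` to `Y`, in `[0, π/2]` and in decreasing order: the
squares of their cosines, in increasing order, are the eigenvalues of `(P_X P_Y)|_X`. -/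
def angles [CompleteSpace H] (X Y : Submodule 𝕜 H) [FiniteDimensional 𝕜 X]
    [FiniteDimensional 𝕜 Y] : Fin (Module.finrank 𝕜 X) → ℝ :=
  fun i => Real.arccos (Real.sqrt (ritzValues (isSelfAdjoint_starProjection Y) X (Fin.rev i)))

/-- `X` corresponds to the top part of the spectrum of `A`: every point of the spectrum of
`(P_X A)|_X` is an upper bound for the spectrum of `(P_{Xᗮ} A)|_{Xᗮ}`. (For self-adjoint `A` both
spectra are real.) -/
def IsTopOfSpectrum (A : H →L[𝕜] H) (X : Submodule 𝕜 H) [X.HasOrthogonalProjection] : Prop :=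
  ∀ r s : ℝ, (r : 𝕜) ∈ spectrum 𝕜 (compression A X) →
    (s : 𝕜) ∈ spectrum 𝕜 (compression A Xᗮ) → s ≤ r

end RayleighRitz

end

/-!
Write `T = (P_X A)|_X - lamMin`, with eigenvalues `β i = lamX i - lamMin ≥ 0`, let `R = √T`, and let
`C = (P_X P_Y)|_X`, whose eigenvalues in increasing order are `γ i = cos² θ i`. Everything is
compared with the eigenvalues `ν` of the operator `R C R` on `X`.

* `ritzValues_le_of_isTopOfSpectrum`: `lamY i ≤ lamX i`, by Courant–Fischer, as the form of `A` on
  `Xᗮ` is at most every eigenvalue on `X` (`re_inner_le_of_forall_mem_spectrum_le`).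
* `le_ritzValues_sub`: `ν i ≤ lamY i - lamMin`. As `X` is invariant, the form of `A - lamMin` on
  `X ⊔ Y` dominates that of `T` composed with `P_X`, and `P_Y P_X T P_X P_Y` has the same nonzero
  eigenvalues as `R C R`.

Hence `lamX i - lamY i ≤ β i - ν i` and `(lamX i - lamMin) / (lamY i - lamMin) ≤ β i / ν i`, and it
remains to compare `R C R` with `R²`.

* Additively, Lidskii's inequality (`DiagonalIn.sum_sub_le`) bounds sums of `β i - ν i` by the
  largest eigenvalues of `R² - R C R = R (1 - C) R`, and Horn's inequality
  (`sum_eigenvalues_congruence_le`) bounds these by the products `β i * (1 - γ i)`.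
* Multiplicatively, `sum_log_sub_eigenvalues_congruence_le` bounds sums of `log β i - log ν i` by
  sums of `- log γ i = log (1 + tan² θ i)`. The bound by `tan² θ i` follows since `exp t - 1` is
  increasing and convex (`WeakMajorizedBy.exp_sub_one`).

Both perturbation bounds replace one operator by a truncation of its spectrum at the `k`-th extreme
eigenvalue. The eigenvalues then move in one direction only, so that a sum over `k` indices is at
most the sum over all indices, which is a trace or the logarithm of a determinant.
-/

noncomputable section

namespace RayleighRitz

/-! ### Weak majorization -/

theorem decreasing_antitone {n : ℕ} (x : Fin n → ℝ) : Antitone (decreasing x) := fun _ _ hij =>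
  Tuple.monotone_sort x (Fin.rev_le_rev.2 hij)

theorem decreasing_comp {n : ℕ} {g : ℝ → ℝ} (hg : Monotone g) (x : Fin n → ℝ) :
    decreasing (fun i => g (x i)) = fun i => g (decreasing x i) := by
  have h : (fun i => g (x i)) ∘ Tuple.sort x =
      (fun i => g (x i)) ∘ Tuple.sort (fun i => g (x i)) :=
    Tuple.comp_sort_eq_comp_iff_monotone.2 (hg.comp (Tuple.monotone_sort x))
  funext i
  exact (congrFun h (Fin.rev i)).symm

theorem decreasing_eq_self {n : ℕ} {x : Fin n → ℝ} (hx : Antitone x) : decreasing x = x := by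
  have h : x ∘ Fin.revPerm = x ∘ Tuple.sort x :=
    Tuple.comp_sort_eq_comp_iff_monotone.2 fun i j hij => hx (by simpa using hij)
  funext i
  simpa [decreasing] using (congrFun h (Fin.rev i)).symm

theorem card_filter_val_lt {n k : ℕ} (hk : k ≤ n) :
    (Finset.univ.filter fun i : Fin n => i.val < k).card = k := by
  rw [Fin.card_filter_val_lt, min_eq_right hk]

/-- To bound the sums of the `k` largest entries it suffices to bound the sums over all
`k`-element sets of indices. -/
theorem weakMajorizedBy_of_forall_sum_le {n : ℕ} {x y : Fin n → ℝ} (hy : Antitone y)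
    (h : ∀ S : Finset (Fin n), ∑ i ∈ S, x i ≤ ∑ i : Fin n with i.val < S.card, y i) :
    WeakMajorizedBy x y := by
  intro k hk
  rw [decreasing_eq_self hy]
  let σ : Fin n ↪ Fin n := Fin.revPerm.toEmbedding.trans (Tuple.sort x).toEmbedding
  have := h ((Finset.univ.filter fun i : Fin n => i.val < k).map σ)
  rw [Finset.card_map, card_filter_val_lt hk, Finset.sum_map] at this
  exact this

theorem sum_filter_val_lt_eq_sum_range {n : ℕ} (f : Fin n → ℝ) (k : ℕ) :
    ∑ i : Fin n with i.val < k, f i =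
      ∑ i ∈ Finset.range k, if h : i < n then f ⟨i, h⟩ else 0 := by
  rw [Finset.sum_filter, Finset.sum_fin_eq_sum_range]
  have h : ∀ a b : ℕ, ∑ i ∈ Finset.range a, (if i < b then
      (if h : i < n then f ⟨i, h⟩ else 0) else 0) =
      ∑ i ∈ (Finset.range a).filter (· < b), if h : i < n then f ⟨i, h⟩ else 0 :=
    fun a b => (Finset.sum_filter _ _).symm
  calc _ = ∑ i ∈ Finset.range n, (if i < k then
        (if h : i < n then f ⟨i, h⟩ else 0) else 0) := by
        refine Finset.sum_congr rfl fun i _ => ?_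
        split_ifs <;> rfl
    _ = ∑ i ∈ Finset.range k, (if i < n then
        (if h : i < n then f ⟨i, h⟩ else 0) else 0) := by
        rw [h, h]
        congr 1
        ext i
        simp [and_comm]
    _ = _ := by
        refine Finset.sum_congr rfl fun i _ => ?_
        split_ifs <;> rfl

/-- Abel's inequality: nonnegative decreasing weights preserve inequalities between all partial
sums. -/
theorem sum_mul_le_sum_mul_of_partial_sums {n : ℕ} {w x y : Fin n → ℝ} (hw : Antitone w)
    (hw0 : ∀ i, 0 ≤ w i)
    (h : ∀ k ≤ n, ∑ i : Fin n with i.val < k, x i ≤ ∑ i : Fin n with i.val < k, y i)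
    {k : ℕ} (hk : k ≤ n) :
    ∑ i : Fin n with i.val < k, w i * x i ≤ ∑ i : Fin n with i.val < k, w i * y i := by
  rw [← sub_nonneg, ← Finset.sum_sub_distrib, sum_filter_val_lt_eq_sum_range]
  set w' : ℕ → ℝ := fun i => if h : i < n then w ⟨i, h⟩ else 0 with hw'
  set z : ℕ → ℝ := fun i => if h : i < n then y ⟨i, h⟩ - x ⟨i, h⟩ else 0 with hz
  have hanti : ∀ i, w' (i + 1) ≤ w' i := by
    intro i
    simp only [hw']
    split_ifs with h1 h2 h2
    · exact hw (by simp [Fin.le_def])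
    · omega
    · exact hw0 _
    · exact le_rfl
  have hw'0 : ∀ i, 0 ≤ w' i := by
    intro i
    simp only [hw']
    split_ifs
    · exact hw0 _
    · exact le_rfl
  have hz0 : ∀ j ≤ n, 0 ≤ ∑ i ∈ Finset.range j, z i := by
    intro j hj
    have := h j hj
    rw [← sub_nonneg, ← Finset.sum_sub_distrib, sum_filter_val_lt_eq_sum_range] at this
    exact this
  have key : ∀ j ≤ n, w' j * ∑ i ∈ Finset.range j, z i ≤ ∑ i ∈ Finset.range j, w' i * z i := by
    intro j
    induction j with
    | zero => simp
    | succ j ih =>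
      intro hj
      calc w' (j + 1) * ∑ i ∈ Finset.range (j + 1), z i
          ≤ w' j * ∑ i ∈ Finset.range (j + 1), z i :=
            mul_le_mul_of_nonneg_right (hanti j) (hz0 _ hj)
        _ ≤ ∑ i ∈ Finset.range (j + 1), w' i * z i := by
            rw [Finset.sum_range_succ, Finset.sum_range_succ, mul_add]
            linarith [ih (by omega)]
  refine ((mul_nonneg (hw'0 k) (hz0 k hk)).trans (key k hk)).trans_eq ?_
  refine Finset.sum_congr rfl fun i _ => ?_
  simp only [hw', hz]
  split_ifs <;> ring

/-- The increasing convex function `t ↦ exp t - 1` preserves weak majorization. -/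
theorem WeakMajorizedBy.exp_sub_one {n : ℕ} {x y : Fin n → ℝ} (h : WeakMajorizedBy x y) :
    WeakMajorizedBy (fun i => Real.exp (x i) - 1) (fun i => Real.exp (y i) - 1) := by
  have hmono : Monotone fun t : ℝ => Real.exp t - 1 := fun s t hst =>
    sub_le_sub_right (Real.exp_le_exp.2 hst) 1
  intro k hk
  rw [decreasing_comp hmono, decreasing_comp hmono]
  have hA := sum_mul_le_sum_mul_of_partial_sums (w := fun i => Real.exp (decreasing x i))
    (fun i j hij => Real.exp_le_exp.2 (decreasing_antitone x hij))
    (fun i => (Real.exp_pos _).le) h hk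
  rw [← sub_nonneg, ← Finset.sum_sub_distrib] at hA ⊢
  refine hA.trans (Finset.sum_le_sum fun i _ => ?_)
  -- the tangent line of `exp` at `decreasing x i`
  have h1 := Real.add_one_le_exp (decreasing y i - decreasing x i)
  have h2 : Real.exp (decreasing y i) =
      Real.exp (decreasing x i) * Real.exp (decreasing y i - decreasing x i) := by
    rw [← Real.exp_add]
    ring_nf
  nlinarith [Real.exp_pos (decreasing x i)]

/-! ### Operators diagonal in an orthonormal basis -/

open scoped InnerProductSpace

section Diagonal

variable {𝕜 : Type*} [RCLike 𝕜] {E : Type*} [NormedAddCommGroup E] [InnerProductSpace 𝕜 E]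
  {n : ℕ}

/-- The operator `T` has the orthonormal eigenbasis `u` with the real eigenvalues `β`, in the order
in which `β` lists them. -/
def DiagonalIn (T : E →ₗ[𝕜] E) (u : OrthonormalBasis (Fin n) 𝕜 E) (β : Fin n → ℝ) : Prop :=
  ∀ i, T (u i) = (β i : 𝕜) • u i

theorem exists_diagonalIn (u : OrthonormalBasis (Fin n) 𝕜 E) (β : Fin n → ℝ) :
    ∃ T : E →ₗ[𝕜] E, DiagonalIn T u β :=
  ⟨u.toBasis.constr 𝕜 fun i => (β i : 𝕜) • u i, fun i => by
    rw [← u.coe_toBasis, Module.Basis.constr_basis]⟩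

theorem _root_.LinearMap.IsSymmetric.diagonalIn [FiniteDimensional 𝕜 E] {T : E →ₗ[𝕜] E}
    (hT : T.IsSymmetric) (hn : Module.finrank 𝕜 E = n) :
    DiagonalIn T (hT.eigenvectorBasis hn) (hT.eigenvalues hn) :=
  fun i => hT.apply_eigenvectorBasis hn i

namespace DiagonalIn

variable {T S : E →ₗ[𝕜] E} {u v : OrthonormalBasis (Fin n) 𝕜 E} {β γ : Fin n → ℝ}

theorem one : DiagonalIn (1 : E →ₗ[𝕜] E) u fun _ => 1 := fun i => by simp

theorem add (hT : DiagonalIn T u β) (hS : DiagonalIn S u γ) :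
    DiagonalIn (T + S) u fun i => β i + γ i := fun i => by
  simp [hT i, hS i, add_smul]

theorem sub (hT : DiagonalIn T u β) (hS : DiagonalIn S u γ) :
    DiagonalIn (T - S) u fun i => β i - γ i := fun i => by
  simp [hT i, hS i, sub_smul]

theorem smul (hT : DiagonalIn T u β) (c : ℝ) :
    DiagonalIn ((c : 𝕜) • T) u fun i => c * β i := fun i => by
  simp [hT i, smul_smul]

theorem comp (hT : DiagonalIn T u β) (hS : DiagonalIn S u γ) :
    DiagonalIn (T ∘ₗ S) u fun i => β i * γ i := fun i => by
  simp [hT i, hS i, smul_smul, mul_comm]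

theorem ext (hT : DiagonalIn T u β) (hS : DiagonalIn S u β) : T = S :=
  u.toBasis.ext fun i => by simp [hT i, hS i]

theorem reindex (hT : DiagonalIn T u β) (σ : Equiv.Perm (Fin n)) :
    DiagonalIn T (u.reindex σ.symm) fun i => β (σ i) := fun i => by
  simpa using hT (σ i)

theorem inner_apply (hT : DiagonalIn T u β) (x : E) (i : Fin n) :
    ⟪u i, T x⟫_𝕜 = β i * ⟪u i, x⟫_𝕜 := by
  conv_lhs => rw [← u.sum_repr' x]
  simp [hT _, inner_sum, inner_smul_right, u.inner_eq_ite, mul_comm]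

theorem isSymmetric (hT : DiagonalIn T u β) : T.IsSymmetric := fun x y => by
  rw [← u.sum_inner_mul_inner, ← u.sum_inner_mul_inner]
  refine Finset.sum_congr rfl fun i _ => ?_
  rw [hT.inner_apply, ← inner_conj_symm (T x), hT.inner_apply, map_mul, inner_conj_symm,
    RCLike.conj_ofReal]
  ring

theorem re_inner (hT : DiagonalIn T u β) (x : E) :
    RCLike.re ⟪T x, x⟫_𝕜 = ∑ i, β i * ‖⟪u i, x⟫_𝕜‖ ^ 2 := by
  rw [← u.sum_inner_mul_inner, map_sum]
  refine Finset.sum_congr rfl fun i _ => ?_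
  rw [← inner_conj_symm (T x), hT.inner_apply, map_mul (starRingEnd 𝕜), RCLike.conj_ofReal,
    mul_assoc, RCLike.conj_mul, ← RCLike.ofReal_pow, ← RCLike.ofReal_mul, RCLike.ofReal_re]

theorem norm_sq_apply (hT : DiagonalIn T u β) (x : E) :
    ‖T x‖ ^ 2 = ∑ i, β i ^ 2 * ‖⟪u i, x⟫_𝕜‖ ^ 2 := by
  rw [← u.sum_sq_norm_inner_right]
  refine Finset.sum_congr rfl fun i _ => ?_
  rw [hT.inner_apply, norm_mul, mul_pow, RCLike.norm_ofReal, sq_abs]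

theorem re_inner_basis (hT : DiagonalIn T u β) (i : Fin n) :
    RCLike.re ⟪T (u i), u i⟫_𝕜 = β i := by
  simp [hT i, inner_smul_left]

theorem re_trace (hT : DiagonalIn T u β) : RCLike.re (T.trace 𝕜 E) = ∑ i, β i := by
  simp [LinearMap.trace_eq_sum_inner T u, hT _, inner_smul_right]

theorem det (hT : DiagonalIn T u β) : LinearMap.det T = ((∏ i, β i : ℝ) : 𝕜) := by
  have h : LinearMap.toMatrix u.toBasis u.toBasis T = Matrix.diagonal fun i => (β i : 𝕜) := by
    ext i j
    rw [LinearMap.toMatrix_apply, u.coe_toBasis, hT j]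
    by_cases hij : i = j
    · subst hij
      simp [RCLike.real_smul_eq_coe_mul]
    · simp [hij]
  rw [← LinearMap.det_toMatrix u.toBasis, h, Matrix.det_diagonal]
  simp

theorem le_re_inner (hT : DiagonalIn T u β) {c : ℝ} (x : E)
    (h : ∀ i, ⟪u i, x⟫_𝕜 = 0 ∨ c ≤ β i) : c * ‖x‖ ^ 2 ≤ RCLike.re ⟪T x, x⟫_𝕜 := by
  rw [hT.re_inner, ← u.sum_sq_norm_inner_right, Finset.mul_sum]
  refine Finset.sum_le_sum fun i _ => ?_
  rcases h i with h | h
  · simp [h]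
  · exact mul_le_mul_of_nonneg_right h (sq_nonneg _)

theorem re_inner_le (hT : DiagonalIn T u β) {c : ℝ} (x : E)
    (h : ∀ i, ⟪u i, x⟫_𝕜 = 0 ∨ β i ≤ c) : RCLike.re ⟪T x, x⟫_𝕜 ≤ c * ‖x‖ ^ 2 := by
  rw [hT.re_inner, ← u.sum_sq_norm_inner_right, Finset.mul_sum]
  refine Finset.sum_le_sum fun i _ => ?_
  rcases h i with h | h
  · simp [h]
  · exact mul_le_mul_of_nonneg_right h (sq_nonneg _)

end DiagonalIn

/-- The dimension count behind the Courant–Fischer principle: the span of the first `i + 1` vectors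
of `u` contains a nonzero vector whose image under `f` satisfies `i` orthogonality conditions. -/
theorem exists_ne_zero_inner_eq_zero {F : Type*} [NormedAddCommGroup F] [InnerProductSpace 𝕜 F]
    (u : OrthonormalBasis (Fin n) 𝕜 E) (f : E →ₗ[𝕜] F) (i : Fin n) (v : Fin i.val → F) :
    ∃ w : E, w ≠ 0 ∧ (∀ l, i < l → ⟪u l, w⟫_𝕜 = 0) ∧ ∀ l, ⟪v l, f w⟫_𝕜 = 0 := by
  let e : Fin (i.val + 1) → E := fun j => u ⟨j.val, by omega⟩
  have he : LinearIndependent 𝕜 e :=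
    u.orthonormal.linearIndependent.comp (fun j : Fin (i.val + 1) => (⟨j.val, by omega⟩ : Fin n))
      fun a b hab => by simpa [Fin.ext_iff] using hab
  let g : (Fin (i.val + 1) → 𝕜) →ₗ[𝕜] E := Fintype.linearCombination 𝕜 e
  let φ : (Fin (i.val + 1) → 𝕜) →ₗ[𝕜] (Fin i.val → 𝕜) :=
    LinearMap.pi fun l => (innerₛₗ 𝕜 (v l)) ∘ₗ f ∘ₗ g
  have hker : LinearMap.ker φ ≠ ⊥ := LinearMap.ker_ne_bot_of_finrank_lt (by simp)
  obtain ⟨c, hc, hc0⟩ := (Submodule.ne_bot_iff _).1 hker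
  refine ⟨g c, fun h => hc0 ?_, fun l hl => ?_, fun l => ?_⟩
  · exact (linearIndependent_iff_injective_fintypeLinearCombination.1 he) (by simpa [g] using h)
  · simp only [g, Fintype.linearCombination_apply, inner_sum, inner_smul_right]
    refine Finset.sum_eq_zero fun j _ => ?_
    rw [show e j = u ⟨j.val, by omega⟩ from rfl, u.inner_eq_ite, if_neg, mul_zero]
    rw [Fin.ext_iff]
    have := j.isLt
    rw [Fin.lt_def] at hl
    simp only
    omega
  · exact congrFun (LinearMap.mem_ker.1 hc) l

/-- Weyl's monotonicity principle: the ordered eigenvalues increase with the quadratic form. -/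
theorem DiagonalIn.le_of_re_inner_le {T S : E →ₗ[𝕜] E} {u v : OrthonormalBasis (Fin n) 𝕜 E}
    {β γ : Fin n → ℝ} (hT : DiagonalIn T u β) (hS : DiagonalIn S v γ) (hβ : Antitone β)
    (hγ : Antitone γ) (h : ∀ x, RCLike.re ⟪T x, x⟫_𝕜 ≤ RCLike.re ⟪S x, x⟫_𝕜) (i : Fin n) :
    β i ≤ γ i := by
  obtain ⟨w, hw, h1, h2⟩ := exists_ne_zero_inner_eq_zero u LinearMap.id i
    fun l => v ⟨l.val, by omega⟩
  have hpos : 0 < ‖w‖ ^ 2 := by positivity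
  have hlow := hT.le_re_inner (c := β i) w fun l => by
    rcases lt_or_ge i l with hl | hl
    · exact Or.inl (h1 l hl)
    · exact Or.inr (hβ hl)
  have hup := hS.re_inner_le (c := γ i) w fun l => by
    rcases lt_or_ge l i with hl | hl
    · exact Or.inl (h2 ⟨l.val, hl⟩)
    · exact Or.inr (hγ hl)
  exact le_of_mul_le_mul_right ((hlow.trans (h w)).trans hup) hpos

end Diagonal

/-! ### Eigenvalue inequalities for congruences -/

section Congruence

variable {𝕜 : Type*} [RCLike 𝕜] {E : Type*} [NormedAddCommGroup E] [InnerProductSpace 𝕜 E]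
  {n : ℕ}

theorem sum_univ_eq_sum_filter_val_lt {f : Fin n → ℝ} {k : ℕ}
    (h : ∀ i : Fin n, k ≤ i.val → f i = 0) :
    ∑ i, f i = ∑ i : Fin n with i.val < k, f i := by
  rw [Finset.sum_filter]
  refine Finset.sum_congr rfl fun i _ => ?_
  split_ifs with hi
  · rfl
  · exact h i (not_lt.1 hi)

theorem sum_filter_val_lt_sub_const (f : Fin n → ℝ) (c : ℝ) {k : ℕ} (hk : k ≤ n) :
    ∑ i : Fin n with i.val < k, (f i - c) = ∑ i : Fin n with i.val < k, f i - k * c := by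
  rw [Finset.sum_sub_distrib, Finset.sum_const, card_filter_val_lt hk, nsmul_eq_mul]

/-- Ky Fan's inequality: the first `k` diagonal entries of an operator in any orthonormal basis have
sum at most that of its `k` largest eigenvalues. -/
theorem DiagonalIn.sum_re_inner_le {T : E →ₗ[𝕜] E} {u : OrthonormalBasis (Fin n) 𝕜 E}
    {β : Fin n → ℝ} (hT : DiagonalIn T u β) (hβ : Antitone β)
    (e : OrthonormalBasis (Fin n) 𝕜 E) {k : ℕ} (hk : k ≤ n) :
    ∑ j : Fin n with j.val < k, RCLike.re ⟪T (e j), e j⟫_𝕜 ≤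
      ∑ j : Fin n with j.val < k, β j := by
  rcases Nat.eq_zero_or_pos k with rfl | hk0
  · simp
  set c := β ⟨k - 1, by omega⟩ with hc
  have h1 : ∀ j, RCLike.re ⟪T (e j), e j⟫_𝕜 - c ≤
      ∑ l : Fin n with l.val < k, (β l - c) * ‖⟪u l, e j⟫_𝕜‖ ^ 2 := by
    intro j
    have : c = ∑ l, c * ‖⟪u l, e j⟫_𝕜‖ ^ 2 := by
      rw [← Finset.mul_sum, u.sum_sq_norm_inner_right]
      simp
    rw [hT.re_inner, this, ← Finset.sum_sub_distrib, ← this, Finset.sum_filter]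
    refine Finset.sum_le_sum fun l _ => ?_
    split_ifs with hl
    · exact (sub_mul _ _ _).ge
    · have : β l ≤ c := hβ (by rw [Fin.le_def]; simp only; omega)
      nlinarith [sq_nonneg ‖⟪u l, e j⟫_𝕜‖]
  have h2 : ∑ j : Fin n with j.val < k, (RCLike.re ⟪T (e j), e j⟫_𝕜 - c) ≤
      ∑ l : Fin n with l.val < k, (β l - c) := by
    refine (Finset.sum_le_sum fun j _ => h1 j).trans ?_
    rw [Finset.sum_comm]
    refine Finset.sum_le_sum fun l hl => ?_
    rw [← Finset.mul_sum]
    have hcl : c ≤ β l := hβ (by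
      have := (Finset.mem_filter.1 hl).2
      rw [Fin.le_def]; simp only; omega)
    refine mul_le_of_le_one_right (sub_nonneg.2 hcl) ?_
    calc ∑ j : Fin n with j.val < k, ‖⟪u l, e j⟫_𝕜‖ ^ 2 ≤ ∑ j, ‖⟪u l, e j⟫_𝕜‖ ^ 2 :=
          Finset.sum_le_sum_of_subset_of_nonneg (Finset.filter_subset _ _)
            fun _ _ _ => sq_nonneg _
      _ = 1 := by
          rw [e.sum_sq_norm_inner_left]
          simp
  rw [sum_filter_val_lt_sub_const _ _ hk, sum_filter_val_lt_sub_const _ _ hk] at h2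
  linarith

/-- Lidskii's inequality for the eigenvalues `β` of `B`, `ν` of `M` and `κ` of `B - M`. -/
theorem DiagonalIn.sum_sub_le {B M : E →ₗ[𝕜] E} {u w z : OrthonormalBasis (Fin n) 𝕜 E}
    {β ν κ : Fin n → ℝ} (hB : DiagonalIn B u β) (hM : DiagonalIn M w ν)
    (hN : DiagonalIn (B - M) z κ) (hβ : Antitone β) (hν : Antitone ν) (hκ : Antitone κ)
    (S : Finset (Fin n)) :
    ∑ i ∈ S, (β i - ν i) ≤ ∑ i : Fin n with i.val < S.card, κ i := by
  have : FiniteDimensional 𝕜 E := u.toBasis.finiteDimensional_of_finite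
  have hk : S.card ≤ n := by simpa using S.card_le_univ
  rcases Nat.eq_zero_or_pos S.card with h0 | hk0
  · simp [Finset.card_eq_zero.1 h0]
  set k := S.card
  -- `P` is the positive part of `B - M - c`, so that `M ≤ M + P` and `B ≤ M + P + c`.
  set c := κ ⟨k - 1, by omega⟩ with hc
  obtain ⟨P, hP⟩ := exists_diagonalIn z fun i => max (κ i - c) 0
  have hn : Module.finrank 𝕜 E = n := by simpa using Module.finrank_eq_card_basis u.toBasis
  have hQs : (M + P).IsSymmetric := hM.isSymmetric.add hP.isSymmetric
  have hQ := hQs.diagonalIn hn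
  set q := hQs.eigenvalues hn
  have hqa : Antitone q := hQs.eigenvalues_antitone hn
  have hq1 : ∀ i, ν i ≤ q i := hM.le_of_re_inner_le hQ hν hqa fun x => by
    have := hP.le_re_inner (c := 0) x fun i => Or.inr (le_max_right _ _)
    simp only [LinearMap.add_apply, inner_add_left, map_add]
    linarith
  have hq2 : ∀ i, β i ≤ q i + c := by
    have hQc := hQ.add ((DiagonalIn.one (u := hQs.eigenvectorBasis hn)).smul c)
    intro i
    have := hB.le_of_re_inner_le hQc hβ (fun i j hij => by simpa using hqa hij) (fun x => ?_) i
    · simpa using this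
    have h1 := ((hP.sub hN).add ((DiagonalIn.one (u := z)).smul c)).le_re_inner (c := 0) x
      fun i => Or.inr (by
        simp only [mul_one]
        linarith [le_max_left (κ i - c) 0])
    simp only [LinearMap.add_apply, LinearMap.sub_apply, inner_add_left, inner_sub_left, map_add,
      map_sub] at h1 ⊢
    linarith
  have htr : ∑ i, (q i - ν i) = ∑ i : Fin n with i.val < k, κ i - k * c := by
    have h1 := hQ.re_trace
    rw [map_add, map_add, hM.re_trace, hP.re_trace,
      sum_univ_eq_sum_filter_val_lt (f := fun i => max (κ i - c) 0) (k := k)] at h1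
    · rw [Finset.sum_sub_distrib, ← h1, add_sub_cancel_left, ← sum_filter_val_lt_sub_const _ _ hk]
      refine Finset.sum_congr rfl fun i hi => max_eq_left (sub_nonneg.2 (hκ ?_))
      have := (Finset.mem_filter.1 hi).2
      rw [Fin.le_def]; simp only; omega
    · intro i hi
      exact max_eq_right (sub_nonpos.2 (hκ (by rw [Fin.le_def]; simp only; omega)))
  calc ∑ i ∈ S, (β i - ν i) ≤ ∑ i ∈ S, ((q i - ν i) + c) :=
        Finset.sum_le_sum fun i _ => by linarith [hq2 i]
    _ = ∑ i ∈ S, (q i - ν i) + k * c := by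
        rw [Finset.sum_add_distrib, Finset.sum_const, nsmul_eq_mul]
    _ ≤ ∑ i, (q i - ν i) + k * c := by
        gcongr
        · exact fun i _ _ => sub_nonneg.2 (hq1 i)
        · exact Finset.subset_univ _
    _ = _ := by rw [htr]; ring

variable {R : E →ₗ[𝕜] E} {u e w z : OrthonormalBasis (Fin n) 𝕜 E} {β γ ν κ : Fin n → ℝ}

theorem re_inner_congruence (hR : R.IsSymmetric) (C : E →ₗ[𝕜] E) (x : E) :
    RCLike.re ⟪(R ∘ₗ C ∘ₗ R) x, x⟫_𝕜 = RCLike.re ⟪C (R x), R x⟫_𝕜 := by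
  rw [LinearMap.comp_apply, LinearMap.comp_apply, hR]

theorem re_inner_comp_self (hR : R.IsSymmetric) (x : E) :
    RCLike.re ⟪(R ∘ₗ R) x, x⟫_𝕜 = ‖R x‖ ^ 2 := by
  rw [LinearMap.comp_apply, hR, inner_self_eq_norm_sq]

/-- Horn's inequality: the eigenvalues `κ` of `R D R` are weakly majorized by the products of the
eigenvalues `δ` of `D` and `β` of `R²`. -/
theorem sum_eigenvalues_congruence_le {D : E →ₗ[𝕜] E} {δ : Fin n → ℝ} (hR : R.IsSymmetric)
    (hB : DiagonalIn (R ∘ₗ R) u β) (hD : DiagonalIn D e δ) (hN : DiagonalIn (R ∘ₗ D ∘ₗ R) z κ)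
    (hβ : Antitone β) (hδ : Antitone δ) (hδ0 : ∀ i, 0 ≤ δ i) {k : ℕ} (hk : k ≤ n) :
    ∑ i : Fin n with i.val < k, κ i ≤ ∑ i : Fin n with i.val < k, β i * δ i := by
  have h1 : ∑ i : Fin n with i.val < k, κ i =
      ∑ j, δ j * ∑ i : Fin n with i.val < k, ‖⟪e j, R (z i)⟫_𝕜‖ ^ 2 := by
    simp_rw [Finset.mul_sum]
    rw [Finset.sum_comm]
    refine Finset.sum_congr rfl fun i _ => ?_
    rw [← hN.re_inner_basis, re_inner_congruence hR, hD.re_inner]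
  have h2 : ∑ i : Fin n with i.val < k, β i * δ i =
      ∑ j, δ j * if j.val < k then β j else 0 := by
    rw [Finset.sum_filter]
    refine Finset.sum_congr rfl fun j _ => ?_
    split_ifs <;> ring
  have hall : ∀ f : Fin n → ℝ, ∑ i, f i = ∑ i : Fin n with i.val < n, f i := fun f =>
    sum_univ_eq_sum_filter_val_lt fun i hi => absurd i.isLt (not_lt.2 hi)
  rw [h1, h2, hall, hall]
  refine sum_mul_le_sum_mul_of_partial_sums hδ hδ0 (fun J hJ => ?_) le_rfl
  have hB' : ∀ x, RCLike.re ⟪(R ∘ₗ R) x, x⟫_𝕜 = ‖R x‖ ^ 2 := re_inner_comp_self hR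
  rcases le_total J k with hJk | hkJ
  · -- Bessel's inequality in `z`, then Ky Fan's inequality in `e`
    have h3 : ∑ i : Fin n with i.val < J, (if i.val < k then β i else 0) =
        ∑ i : Fin n with i.val < J, β i := Finset.sum_congr rfl fun i hi =>
      if_pos ((Finset.mem_filter.1 hi).2.trans_le hJk)
    rw [h3]
    refine le_trans (Finset.sum_le_sum fun j _ => ?_) (hB.sum_re_inner_le hβ e hJ)
    rw [hB', ← z.sum_sq_norm_inner_left]
    simp_rw [← hR (e j) _]
    exact Finset.sum_le_sum_of_subset_of_nonneg (Finset.filter_subset _ _)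
      fun _ _ _ => sq_nonneg _
  · -- Bessel's inequality in `e`, then Ky Fan's inequality in `z`
    have h3 : ∑ i : Fin n with i.val < J, (if i.val < k then β i else 0) =
        ∑ i : Fin n with i.val < k, β i := by
      rw [← Finset.sum_filter, Finset.filter_filter]
      refine Finset.sum_congr (Finset.filter_congr fun i _ => ?_) fun _ _ => rfl
      omega
    rw [h3, Finset.sum_comm]
    refine le_trans (Finset.sum_le_sum fun i _ => ?_) (hB.sum_re_inner_le hβ z hk)
    rw [hB', ← e.sum_sq_norm_inner_right]
    exact Finset.sum_le_sum_of_subset_of_nonneg (Finset.filter_subset _ _)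
      fun _ _ _ => sq_nonneg _

/-- The additive perturbation bound for the eigenvalues `ν` of `R C R` against the eigenvalues `β`
of `R²`, where `C ≤ 1` has the increasing eigenvalues `γ`. -/
theorem sum_sub_eigenvalues_congruence_le {C : E →ₗ[𝕜] E} (hR : R.IsSymmetric)
    (hB : DiagonalIn (R ∘ₗ R) u β) (hC : DiagonalIn C e γ) (hM : DiagonalIn (R ∘ₗ C ∘ₗ R) w ν)
    (hβ : Antitone β) (hγ : Monotone γ) (hν : Antitone ν) (hγ1 : ∀ i, γ i ≤ 1)
    (S : Finset (Fin n)) :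
    ∑ i ∈ S, (β i - ν i) ≤ ∑ i : Fin n with i.val < S.card, β i * (1 - γ i) := by
  have : FiniteDimensional 𝕜 E := u.toBasis.finiteDimensional_of_finite
  have hn : Module.finrank 𝕜 E = n := by simpa using Module.finrank_eq_card_basis u.toBasis
  have hNs := hB.isSymmetric.sub hM.isSymmetric
  have hN := hNs.diagonalIn hn
  refine (hB.sum_sub_le hM hN hβ hν (hNs.eigenvalues_antitone hn) S).trans ?_
  have hD := (DiagonalIn.one (u := e)).sub hC
  have hRDR : R ∘ₗ R - R ∘ₗ C ∘ₗ R = R ∘ₗ ((1 : E →ₗ[𝕜] E) - C) ∘ₗ R := by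
    ext x
    simp
  have hN' : DiagonalIn (R ∘ₗ ((1 : E →ₗ[𝕜] E) - C) ∘ₗ R) (hNs.eigenvectorBasis hn)
      (hNs.eigenvalues hn) := fun i => by
    rw [← hRDR]
    exact hN i
  exact sum_eigenvalues_congruence_le hR hB hD hN' hβ (fun i j hij => sub_le_sub_left (hγ hij) 1)
    (fun i => sub_nonneg.2 (hγ1 i)) (by simpa using S.card_le_univ)

theorem mul_le_eigenvalues_congruence {C : E →ₗ[𝕜] E} (hR : R.IsSymmetric)
    (hB : DiagonalIn (R ∘ₗ R) u β) (hC : DiagonalIn C e γ) (hM : DiagonalIn (R ∘ₗ C ∘ₗ R) w ν)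
    (hβ : Antitone β) (hν : Antitone ν) {c : ℝ} (hc0 : 0 ≤ c) (hc : ∀ i, c ≤ γ i) (i : Fin n) :
    c * β i ≤ ν i := by
  refine (hB.smul c).le_of_re_inner_le hM (fun i j hij => mul_le_mul_of_nonneg_left (hβ hij) hc0)
    hν (fun x => ?_) i
  rw [re_inner_congruence hR, LinearMap.smul_apply, inner_smul_left, RCLike.conj_ofReal,
    RCLike.re_ofReal_mul, re_inner_comp_self hR]
  exact hC.le_re_inner _ fun i => Or.inr (hc i)

theorem eigenvalues_congruence_le_mul {C : E →ₗ[𝕜] E} (hR : R.IsSymmetric)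
    (hB : DiagonalIn (R ∘ₗ R) u β) (hC : DiagonalIn C e γ) (hM : DiagonalIn (R ∘ₗ C ∘ₗ R) w ν)
    (hβ : Antitone β) (hν : Antitone ν) {c : ℝ} (hc0 : 0 ≤ c) (hc : ∀ i, γ i ≤ c) (i : Fin n) :
    ν i ≤ c * β i := by
  refine hM.le_of_re_inner_le (hB.smul c) hν
    (fun i j hij => mul_le_mul_of_nonneg_left (hβ hij) hc0) (fun x => ?_) i
  rw [re_inner_congruence hR, LinearMap.smul_apply, inner_smul_left, RCLike.conj_ofReal,
    RCLike.re_ofReal_mul, re_inner_comp_self hR]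
  exact hC.re_inner_le _ fun i => Or.inr (hc i)

theorem prod_eigenvalues_congruence {C : E →ₗ[𝕜] E} (hB : DiagonalIn (R ∘ₗ R) u β)
    (hC : DiagonalIn C e γ) (hM : DiagonalIn (R ∘ₗ C ∘ₗ R) w ν) :
    ∏ i, ν i = (∏ i, β i) * ∏ i, γ i := by
  have h := hM.det
  rw [LinearMap.det_comp, LinearMap.det_comp, mul_left_comm, ← LinearMap.det_comp, hB.det, hC.det,
    ← RCLike.ofReal_mul, RCLike.ofReal_inj] at h
  rw [← h, mul_comm]

/-- The multiplicative perturbation bound, in logarithmic form, for the eigenvalues `ν` of `R C R`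
against the eigenvalues `β` of `R²`, where `C` has the increasing eigenvalues `γ`. -/
theorem sum_log_sub_eigenvalues_congruence_le {C : E →ₗ[𝕜] E} (hR : R.IsSymmetric)
    (hB : DiagonalIn (R ∘ₗ R) u β) (hC : DiagonalIn C e γ) (hM : DiagonalIn (R ∘ₗ C ∘ₗ R) w ν)
    (hβ : Antitone β) (hγ : Monotone γ) (hν : Antitone ν) (hβ0 : ∀ i, 0 < β i)
    (hγ0 : ∀ i, 0 < γ i) (S : Finset (Fin n)) :
    ∑ i ∈ S, (Real.log (β i) - Real.log (ν i)) ≤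
      ∑ i : Fin n with i.val < S.card, -Real.log (γ i) := by
  have : FiniteDimensional 𝕜 E := u.toBasis.finiteDimensional_of_finite
  have hn : Module.finrank 𝕜 E = n := by simpa using Module.finrank_eq_card_basis u.toBasis
  have hk : S.card ≤ n := by simpa using S.card_le_univ
  rcases Nat.eq_zero_or_pos S.card with h0 | hk0
  · simp [Finset.card_eq_zero.1 h0]
  set k := S.card
  -- Truncating the spectrum of `C` at its `k`-th smallest eigenvalue `c` gives `C' ≤ C` with
  -- `C' ≤ c`, so that each `log (c * β i) - log (q i)` below is nonnegative.
  set c := γ ⟨k - 1, by omega⟩ with hc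
  have hcpos : 0 < c := hγ0 _
  obtain ⟨C', hC'⟩ := exists_diagonalIn e fun i => min (γ i) c
  have hQs : (R ∘ₗ C' ∘ₗ R).IsSymmetric := fun x y => by
    simp only [LinearMap.comp_apply]
    rw [hR, hC'.isSymmetric, hR]
  have hQ := hQs.diagonalIn hn
  set q := hQs.eigenvalues hn
  have hqa : Antitone q := hQs.eigenvalues_antitone hn
  have hqν : ∀ i, q i ≤ ν i := hQ.le_of_re_inner_le hM hqa hν fun x => by
    rw [re_inner_congruence hR, re_inner_congruence hR, hC'.re_inner, hC.re_inner]
    exact Finset.sum_le_sum fun i _ =>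
      mul_le_mul_of_nonneg_right (min_le_left _ _) (sq_nonneg _)
  have hqc : ∀ i, q i ≤ c * β i :=
    eigenvalues_congruence_le_mul hR hB hC' hQ hβ hqa hcpos.le fun i => min_le_right _ _
  have hq0 : ∀ i, 0 < q i := fun i => by
    refine lt_of_lt_of_le (mul_pos (hγ0 ⟨0, by omega⟩) (hβ0 i))
      (mul_le_eigenvalues_congruence hR hB hC' hQ hβ hqa (hγ0 _).le (fun j => ?_) i)
    exact le_min (hγ (by rw [Fin.le_def]; exact Nat.zero_le _))
      (hγ (by rw [Fin.le_def]; exact Nat.zero_le _))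
  have hdet := congrArg Real.log (prod_eigenvalues_congruence hB hC' hQ)
  rw [Real.log_mul (Finset.prod_ne_zero_iff.2 fun i _ => (hβ0 i).ne')
      (Finset.prod_ne_zero_iff.2 fun i _ => (lt_min (hγ0 i) hcpos).ne'),
    Real.log_prod fun i _ => (hq0 i).ne', Real.log_prod fun i _ => (hβ0 i).ne',
    Real.log_prod fun i _ => (lt_min (hγ0 i) hcpos).ne'] at hdet
  have hall : ∑ i, (Real.log (c * β i) - Real.log (q i)) =
      ∑ i : Fin n with i.val < k, -Real.log (γ i) + k * Real.log c := by
    have h1 : ∑ i, (Real.log (c * β i) - Real.log (q i)) =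
        ∑ i, (-Real.log (min (γ i) c) - -Real.log c) := by
      have : ∀ i, Real.log (c * β i) = Real.log c + Real.log (β i) := fun i =>
        Real.log_mul hcpos.ne' (hβ0 i).ne'
      simp only [this, Finset.sum_sub_distrib, Finset.sum_add_distrib, Finset.sum_neg_distrib]
      linarith
    rw [h1, sum_univ_eq_sum_filter_val_lt (k := k), sum_filter_val_lt_sub_const _ _ hk]
    · rw [mul_neg, sub_neg_eq_add]
      congr 1
      refine Finset.sum_congr rfl fun i hi => ?_
      rw [min_eq_left]
      refine hγ ?_
      have := (Finset.mem_filter.1 hi).2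
      rw [Fin.le_def]; simp only; omega
    · intro i hi
      rw [min_eq_right, sub_self]
      exact hγ (by rw [Fin.le_def]; simp only; omega)
  have hterm : ∀ i, 0 ≤ Real.log (c * β i) - Real.log (q i) := fun i =>
    sub_nonneg.2 (Real.log_le_log (hq0 i) (hqc i))
  calc ∑ i ∈ S, (Real.log (β i) - Real.log (ν i))
      ≤ ∑ i ∈ S, ((Real.log (c * β i) - Real.log (q i)) - Real.log c) :=
        Finset.sum_le_sum fun i _ => by
          rw [Real.log_mul hcpos.ne' (hβ0 i).ne']
          linarith [Real.log_le_log (hq0 i) (hqν i)]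
    _ = ∑ i ∈ S, (Real.log (c * β i) - Real.log (q i)) - k * Real.log c := by
        rw [Finset.sum_sub_distrib, Finset.sum_const, nsmul_eq_mul]
    _ ≤ ∑ i, (Real.log (c * β i) - Real.log (q i)) - k * Real.log c := by
        gcongr
        · exact fun i _ _ => hterm i
        · exact Finset.subset_univ _
    _ = _ := by rw [hall]; ring

end Congruence

/-! ### Quadratic forms of self-adjoint operators and their Ritz values -/

section Ritz

variable {𝕜 : Type*} [RCLike 𝕜] {H : Type*} [NormedAddCommGroup H] [InnerProductSpace 𝕜 H]

/-- The quadratic form of a symmetric operator is bounded by any upper bound of its real spectrum.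
After adding `‖T‖` the operator is positive, so that its norm is the supremum of its Rayleigh
quotient and lies in its spectrum. -/
theorem re_inner_le_of_forall_mem_spectrum_le {T : H →L[𝕜] H}
    (hT : (T : H →ₗ[𝕜] H).IsSymmetric) {r : ℝ} (h : ∀ s : ℝ, (s : 𝕜) ∈ spectrum 𝕜 T → s ≤ r)
    (x : H) : RCLike.re ⟪T x, x⟫_𝕜 ≤ r * ‖x‖ ^ 2 := by
  rcases subsingleton_or_nontrivial H with hs | hs
  · simp [Subsingleton.elim x 0]
  set T' : H →L[𝕜] H := T + algebraMap 𝕜 (H →L[𝕜] H) (‖T‖ : ℝ) with hT'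
  have happ : ∀ y, T' y = T y + ((‖T‖ : ℝ) : 𝕜) • y := fun y => by
    rw [hT', Algebra.algebraMap_eq_smul_one]
    rfl
  have hform : ∀ y, RCLike.re ⟪T' y, y⟫_𝕜 = RCLike.re ⟪T y, y⟫_𝕜 + ‖T‖ * ‖y‖ ^ 2 := fun y => by
    rw [happ, inner_add_left, map_add, inner_smul_left, RCLike.conj_ofReal, RCLike.re_ofReal_mul,
      inner_self_eq_norm_sq]
  have hsymm : (T' : H →ₗ[𝕜] H).IsSymmetric := fun y z => by
    have := hT y z
    simp only [ContinuousLinearMap.coe_coe] at this ⊢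
    rw [happ, happ, inner_add_left, inner_add_right, inner_smul_left, inner_smul_right,
      RCLike.conj_ofReal, this]
  have hpos : ∀ y, 0 ≤ T'.rayleighQuotient y := fun y => by
    refine div_nonneg ?_ (sq_nonneg _)
    rw [ContinuousLinearMap.reApplyInnerSelf_apply, hform]
    have h1 : |RCLike.re ⟪T y, y⟫_𝕜| ≤ ‖T‖ * ‖y‖ ^ 2 := by
      refine (RCLike.abs_re_le_norm _).trans ((norm_inner_le_norm _ _).trans ?_)
      rw [sq, ← mul_assoc]
      gcongr
      exact T.le_opNorm y
    linarith [neg_le_of_abs_le h1]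
  have hmem : ((‖T'‖ : ℝ) : 𝕜) ∈ spectrum 𝕜 T' := by
    by_contra hcon
    obtain ⟨ε, hε, hle⟩ := T'.rayleighQuotient_le_of_norm_mem_resolventSet
      (by simpa [spectrum] using hcon)
    have h1 := T'.norm_eq_iSup_rayleighQuotient hsymm
    have h2 : (⨆ y, |T'.rayleighQuotient y|) ≤ ‖T'‖ - ε :=
      ciSup_le fun y => by rw [abs_of_nonneg (hpos y)]; exact hle y
    linarith
  have hmem' : ((‖T'‖ - ‖T‖ : ℝ) : 𝕜) ∈ spectrum 𝕜 T := by
    rw [spectrum.mem_iff] at hmem ⊢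
    convert! hmem using 2
    rw [hT', RCLike.ofReal_sub, map_sub]
    abel
  have h3 := h _ hmem'
  have h4 : RCLike.re ⟪T' x, x⟫_𝕜 ≤ ‖T'‖ * ‖x‖ ^ 2 := by
    refine (RCLike.re_le_norm _).trans ((norm_inner_le_norm _ _).trans ?_)
    rw [sq, ← mul_assoc]
    gcongr
    exact T'.le_opNorm x
  rw [hform] at h4
  nlinarith [sq_nonneg ‖x‖]

theorem mem_spectrum_of_apply_eq_smul {T : H →L[𝕜] H} {c : 𝕜} {x : H} (hx : x ≠ 0)
    (h : T x = c • x) : c ∈ spectrum 𝕜 T := by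
  rw [spectrum.mem_iff]
  rintro ⟨f, hf⟩
  have h1 : (f : H →L[𝕜] H) x = 0 := by
    simp [hf, Algebra.algebraMap_eq_smul_one, h]
  have h2 : (↑f⁻¹ : H →L[𝕜] H) ((f : H →L[𝕜] H) x) = x := by
    rw [← mul_apply_eq_comp, f.inv_mul, one_apply_eq_self]
  exact hx (by rw [← h2, h1, map_zero])

theorem inner_compression (A : H →L[𝕜] H) (U : Submodule 𝕜 H) [U.HasOrthogonalProjection]
    (x y : U) : ⟪compression A U x, y⟫_𝕜 = ⟪A x, (y : H)⟫_𝕜 := by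
  simp [compression]

theorem norm_sq_add_of_orthogonal {X : Submodule 𝕜 H} {x z : H} (hx : x ∈ X) (hz : z ∈ Xᗮ) :
    ‖x + z‖ ^ 2 = ‖x‖ ^ 2 + ‖z‖ ^ 2 := by
  rw [sq, sq, sq, norm_add_sq_eq_norm_sq_add_norm_sq_of_inner_eq_zero x z
    ((Submodule.mem_orthogonal _ _).1 hz x hx)]

theorem re_inner_starProjection (U : Submodule 𝕜 H) [U.HasOrthogonalProjection] (x : H) :
    RCLike.re ⟪U.starProjection x, x⟫_𝕜 = ‖U.starProjection x‖ ^ 2 := by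
  rw [← inner_self_eq_norm_sq (𝕜 := 𝕜), ← Submodule.inner_starProjection_left_eq_right,
    Submodule.starProjection_eq_self_iff.2 (U.starProjection_apply_mem _)]

variable [CompleteSpace H] {A : H →L[𝕜] H}

theorem diagonalIn_ritzValues (hA : IsSelfAdjoint A) (U : Submodule 𝕜 H) [FiniteDimensional 𝕜 U] :
    DiagonalIn (compression A U : U →ₗ[𝕜] U)
      ((compression_isSymmetric hA U).eigenvectorBasis rfl) (ritzValues hA U) :=
  (compression_isSymmetric hA U).diagonalIn rfl

theorem ritzValues_antitone (hA : IsSelfAdjoint A) (U : Submodule 𝕜 H) [FiniteDimensional 𝕜 U] :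
    Antitone (ritzValues hA U) :=
  (compression_isSymmetric hA U).eigenvalues_antitone rfl

theorem le_ritzValues (hA : IsSelfAdjoint A) (U : Submodule 𝕜 H) [FiniteDimensional 𝕜 U] {c : ℝ}
    (h : ∀ x ∈ U, c * ‖x‖ ^ 2 ≤ RCLike.re ⟪A x, x⟫_𝕜) (i : Fin (Module.finrank 𝕜 U)) :
    c ≤ ritzValues hA U i := by
  rw [← (diagonalIn_ritzValues hA U).re_inner_basis, ContinuousLinearMap.coe_coe,
    inner_compression]
  have h1 := h _ ((compression_isSymmetric hA U).eigenvectorBasis rfl i).2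
  have h2 := ((compression_isSymmetric hA U).eigenvectorBasis rfl).norm_eq_one i
  rw [Submodule.coe_norm] at h2
  rw [h2] at h1
  simpa using h1

theorem ritzValues_le (hA : IsSelfAdjoint A) (U : Submodule 𝕜 H) [FiniteDimensional 𝕜 U] {c : ℝ}
    (h : ∀ x ∈ U, RCLike.re ⟪A x, x⟫_𝕜 ≤ c * ‖x‖ ^ 2) (i : Fin (Module.finrank 𝕜 U)) :
    ritzValues hA U i ≤ c := by
  rw [← (diagonalIn_ritzValues hA U).re_inner_basis, ContinuousLinearMap.coe_coe,
    inner_compression]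
  have h1 := h _ ((compression_isSymmetric hA U).eigenvectorBasis rfl i).2
  have h2 := ((compression_isSymmetric hA U).eigenvectorBasis rfl).norm_eq_one i
  rw [Submodule.coe_norm] at h2
  rw [h2] at h1
  simpa using h1

theorem minRitzValue_mul_le (hA : IsSelfAdjoint A) {U : Submodule 𝕜 H} [FiniteDimensional 𝕜 U]
    {x : H} (hx : x ∈ U) : minRitzValue hA U * ‖x‖ ^ 2 ≤ RCLike.re ⟪A x, x⟫_𝕜 := by
  have h := (diagonalIn_ritzValues hA U).le_re_inner (c := minRitzValue hA U) ⟨x, hx⟩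
    fun i => Or.inr (ciInf_le (Set.finite_range _).bddBelow i)
  rwa [ContinuousLinearMap.coe_coe, inner_compression] at h

theorem re_inner_add_of_invariant (hA : IsSelfAdjoint A) {X : Submodule 𝕜 H}
    (hinv : ∀ x ∈ X, A x ∈ X) {x z : H} (hx : x ∈ X) (hz : z ∈ Xᗮ) :
    RCLike.re ⟪A (x + z), x + z⟫_𝕜 = RCLike.re ⟪A x, x⟫_𝕜 + RCLike.re ⟪A z, z⟫_𝕜 := by
  have h1 : ⟪A x, z⟫_𝕜 = 0 := (Submodule.mem_orthogonal _ _).1 hz _ (hinv x hx)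
  have h2 : ⟪A z, x⟫_𝕜 = 0 := by
    have := hA.isSymmetric z x
    simp only [ContinuousLinearMap.coe_coe] at this
    rw [this]
    exact (Submodule.mem_orthogonal' _ _).1 hz _ (hinv x hx)
  simp [inner_add_left, inner_add_right, h1, h2]

/-- The Courant–Fischer principle for a top invariant subspace. -/
theorem ritzValues_le_of_isTopOfSpectrum (hA : IsSelfAdjoint A) (X Y : Submodule 𝕜 H)
    [FiniteDimensional 𝕜 X] [FiniteDimensional 𝕜 Y]
    (hXY : Module.finrank 𝕜 X ≤ Module.finrank 𝕜 Y) (hinv : ∀ x ∈ X, A x ∈ X)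
    (htop : IsTopOfSpectrum A X) (i : Fin (Module.finrank 𝕜 X)) :
    ritzValues hA Y (Fin.castLE hXY i) ≤ ritzValues hA X i := by
  have hTX := diagonalIn_ritzValues hA X
  have hTY := diagonalIn_ritzValues hA Y
  set u := (compression_isSymmetric hA X).eigenvectorBasis rfl
  obtain ⟨w, hw, h1, h2⟩ := exists_ne_zero_inner_eq_zero
    ((compression_isSymmetric hA Y).eigenvectorBasis rfl) Y.subtype (Fin.castLE hXY i)
    fun l => (u ⟨l.val, l.isLt.trans i.isLt⟩ : H)
  have hlow := hTY.le_re_inner (c := ritzValues hA Y (Fin.castLE hXY i)) w fun l => by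
    rcases lt_or_ge (Fin.castLE hXY i) l with hl | hl
    · exact Or.inl (h1 l hl)
    · exact Or.inr (ritzValues_antitone hA Y hl)
  rw [ContinuousLinearMap.coe_coe, inner_compression] at hlow
  set x : X := X.orthogonalProjectionOnto (w : H) with hx
  set z : H := (w : H) - x with hz
  have hzX : z ∈ Xᗮ := X.sub_starProjection_mem_orthogonal (w : H)
  have hwxz : (w : H) = x + z := by rw [hz]; abel
  have hxle := hTX.re_inner_le (c := ritzValues hA X i) x fun l => by
    rcases lt_or_ge l i with hl | hl
    · refine Or.inl ?_
      have := h2 ⟨l.val, hl⟩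
      rw [Submodule.coe_subtype, hwxz, inner_add_right,
        (Submodule.mem_orthogonal _ _).1 hzX _ (u l).2, add_zero] at this
      exact this
    · exact Or.inr (ritzValues_antitone hA X hl)
  rw [ContinuousLinearMap.coe_coe, inner_compression] at hxle
  have hspec : ((ritzValues hA X i : ℝ) : 𝕜) ∈ spectrum 𝕜 (compression A X) :=
    mem_spectrum_of_apply_eq_smul (u.orthonormal.ne_zero i) (hTX i)
  have hzle := re_inner_le_of_forall_mem_spectrum_le (compression_isSymmetric hA Xᗮ)
    (fun s hs => htop _ s hspec hs) ⟨z, hzX⟩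
  rw [inner_compression] at hzle
  simp only [Submodule.coe_norm] at hzle hxle hlow
  rw [hwxz, re_inner_add_of_invariant hA hinv x.2 hzX, norm_sq_add_of_orthogonal x.2 hzX] at hlow
  have hpos : 0 < ‖(x : H)‖ ^ 2 + ‖z‖ ^ 2 := by
    rw [← norm_sq_add_of_orthogonal x.2 hzX, ← hwxz]
    have : (w : H) ≠ 0 := by simpa using hw
    positivity
  nlinarith

/-- The Ritz values on `Y`, shifted by a lower bound `c` of the form of `A` on `X ⊔ Y`, dominate
the eigenvalues of `R C R`, where `R² = (P_X A)|_X - c` and `C = (P_X P_Y)|_X`. The test vectors are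
`P_Y R x` for `x` in a top eigenspace of `R C R`. -/
theorem le_ritzValues_sub (hA : IsSelfAdjoint A) (X Y : Submodule 𝕜 H)
    [FiniteDimensional 𝕜 X] [FiniteDimensional 𝕜 Y]
    (hXY : Module.finrank 𝕜 X ≤ Module.finrank 𝕜 Y) (hinv : ∀ x ∈ X, A x ∈ X) {c : ℝ}
    (hc : ∀ x ∈ X ⊔ Y, c * ‖x‖ ^ 2 ≤ RCLike.re ⟪A x, x⟫_𝕜) {R : X →ₗ[𝕜] X} (hR : R.IsSymmetric)
    (hB : R ∘ₗ R = (compression A X : X →ₗ[𝕜] X) - (c : 𝕜) • 1)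
    {w : OrthonormalBasis (Fin (Module.finrank 𝕜 X)) 𝕜 X} {ν : Fin (Module.finrank 𝕜 X) → ℝ}
    (hM : DiagonalIn (R ∘ₗ (compression Y.starProjection X : X →ₗ[𝕜] X) ∘ₗ R) w ν)
    (hν : Antitone ν) (i : Fin (Module.finrank 𝕜 X)) :
    ν i ≤ ritzValues hA Y (Fin.castLE hXY i) - c := by
  rcases le_or_gt (ν i) 0 with hi0 | hi0
  · exact hi0.trans (sub_nonneg.2 (le_ritzValues hA Y
      (fun x hx => hc x (Submodule.mem_sup_right hx)) _))
  have hTY := diagonalIn_ritzValues hA Y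
  set v := (compression_isSymmetric hA Y).eigenvectorBasis rfl
  set f : X →ₗ[𝕜] Y := (Y.orthogonalProjectionOnto : H →ₗ[𝕜] Y) ∘ₗ X.subtype ∘ₗ R
  obtain ⟨a, ha, h1, h2⟩ := exists_ne_zero_inner_eq_zero w f i
    fun l => v (Fin.castLE hXY ⟨l.val, l.isLt.trans i.isLt⟩)
  set y : Y := f a with hy
  have hyproj : (y : H) = Y.starProjection (R a : H) := rfl
  have hnorm : RCLike.re ⟪(R ∘ₗ (compression Y.starProjection X : X →ₗ[𝕜] X) ∘ₗ R) a, a⟫_𝕜 =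
      ‖(y : H)‖ ^ 2 := by
    rw [re_inner_congruence hR, ContinuousLinearMap.coe_coe, inner_compression, hyproj,
      re_inner_starProjection]
  have hypos : 0 < ‖(y : H)‖ ^ 2 := by
    have hle := hM.le_re_inner (c := ν i) a fun l => by
      rcases lt_or_ge i l with hl | hl
      · exact Or.inl (h1 l hl)
      · exact Or.inr (hν hl)
    rw [hnorm] at hle
    exact lt_of_lt_of_le (mul_pos hi0 (by positivity)) hle
  have hup := hTY.re_inner_le (c := ritzValues hA Y (Fin.castLE hXY i)) y fun l => by
    rcases lt_or_ge l (Fin.castLE hXY i) with hl | hl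
    · exact Or.inl (h2 ⟨l.val, hl⟩)
    · exact Or.inr (ritzValues_antitone hA Y hl)
  rw [ContinuousLinearMap.coe_coe, inner_compression] at hup
  set x : X := X.orthogonalProjectionOnto (y : H) with hx
  set z : H := (y : H) - x with hz
  have hzX : z ∈ Xᗮ := X.sub_starProjection_mem_orthogonal (y : H)
  have hyxz : (y : H) = x + z := by rw [hz]; abel
  have hzc := hc z (Submodule.sub_mem _ (Submodule.mem_sup_right y.2)
    (Submodule.mem_sup_left x.2))
  have hRx : R x = (R ∘ₗ (compression Y.starProjection X : X →ₗ[𝕜] X) ∘ₗ R) a := rfl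
  have hxform : RCLike.re ⟪A x, (x : H)⟫_𝕜 = ‖R x‖ ^ 2 + c * ‖(x : H)‖ ^ 2 := by
    rw [← re_inner_comp_self hR, hB, ← inner_compression, LinearMap.sub_apply, inner_sub_left,
      map_sub, LinearMap.smul_apply, inner_smul_left, RCLike.conj_ofReal, RCLike.re_ofReal_mul,
      Module.End.one_apply, inner_self_eq_norm_sq]
    simp
  have hMa : ν i * ‖(y : H)‖ ^ 2 ≤ ‖R x‖ ^ 2 := by
    rw [hRx, hM.norm_sq_apply, ← hnorm, hM.re_inner, Finset.mul_sum]
    refine Finset.sum_le_sum fun l _ => ?_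
    rcases lt_or_ge i l with hl | hl
    · simp [h1 l hl]
    · rw [← mul_assoc, sq (ν l)]
      have := hν hl
      gcongr
      exact hi0.le.trans this
  have hsplit := re_inner_add_of_invariant hA hinv x.2 hzX
  have hnsplit := norm_sq_add_of_orthogonal x.2 hzX
  rw [← hyxz] at hsplit hnsplit
  simp only [Submodule.coe_norm] at hup hMa
  refine le_of_mul_le_mul_right ?_ hypos
  rw [sub_mul]
  rw [Submodule.coe_norm] at hxform
  have : c * ‖(y : H)‖ ^ 2 = c * ‖(x : H)‖ ^ 2 + c * ‖z‖ ^ 2 := by rw [hnsplit, mul_add]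
  linarith

end Ritz

/-! ### Principal angles -/

section Angles

variable {𝕜 : Type*} [RCLike 𝕜] {H : Type*} [NormedAddCommGroup H] [InnerProductSpace 𝕜 H]
  [CompleteSpace H] (X Y : Submodule 𝕜 H) [FiniteDimensional 𝕜 X] [FiniteDimensional 𝕜 Y]

/-- The squared cosines of the principal angles from `X` to `Y`, in increasing order. -/
def cosSq : Fin (Module.finrank 𝕜 X) → ℝ :=
  fun i => ritzValues (isSelfAdjoint_starProjection Y) X (Fin.rev i)

theorem cosSq_monotone : Monotone (cosSq X Y) := fun _ _ hij =>
  ritzValues_antitone _ X (Fin.rev_le_rev.2 hij)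

theorem cosSq_nonneg (i : Fin (Module.finrank 𝕜 X)) : 0 ≤ cosSq X Y i :=
  le_ritzValues _ X (fun x _ => by
    rw [re_inner_starProjection, zero_mul]
    exact sq_nonneg _) _

theorem cosSq_le_one (i : Fin (Module.finrank 𝕜 X)) : cosSq X Y i ≤ 1 :=
  ritzValues_le _ X (fun x _ => by
    rw [re_inner_starProjection, one_mul]
    gcongr
    exact Y.norm_starProjection_apply_le x) _

theorem cos_sq_angles (i : Fin (Module.finrank 𝕜 X)) :
    Real.cos (angles X Y i) ^ 2 = cosSq X Y i := by
  have h0 := Real.sqrt_nonneg (cosSq X Y i)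
  change Real.cos (Real.arccos (Real.sqrt (cosSq X Y i))) ^ 2 = _
  rw [Real.cos_arccos (by linarith) (Real.sqrt_le_one.2 (cosSq_le_one X Y i)),
    Real.sq_sqrt (cosSq_nonneg X Y i)]

theorem sin_sq_angles (i : Fin (Module.finrank 𝕜 X)) :
    Real.sin (angles X Y i) ^ 2 = 1 - cosSq X Y i := by
  rw [Real.sin_sq, cos_sq_angles]

theorem cosSq_pos_of_angles_lt {i : Fin (Module.finrank 𝕜 X)}
    (h : angles X Y i < Real.pi / 2) : 0 < cosSq X Y i :=
  Real.sqrt_pos.1 (Real.arccos_lt_pi_div_two.1 h)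

theorem one_add_tan_sq_angles {i : Fin (Module.finrank 𝕜 X)}
    (h : angles X Y i < Real.pi / 2) : 1 + Real.tan (angles X Y i) ^ 2 = (cosSq X Y i)⁻¹ := by
  have h0 := cosSq_pos_of_angles_lt X Y h
  have hcos : Real.cos (angles X Y i) ≠ 0 := by
    rw [← cos_sq_angles] at h0
    exact fun h => by simp [h] at h0
  rw [← cos_sq_angles, ← Real.inv_one_add_tan_sq hcos, inv_inv]

end Angles

end RayleighRitz

end

/-! ### Majorization of the Ritz value errors -/

open RayleighRitz

theorem theorem2p7 {𝕜 : Type*} [RCLike 𝕜] {H : Type*} [NormedAddCommGroup H]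
    [InnerProductSpace 𝕜 H] [CompleteSpace H] (hH : ¬ FiniteDimensional 𝕜 H)
    (A : H →L[𝕜] H) (hA : IsSelfAdjoint A)
    (X Y : Submodule 𝕜 H) [FiniteDimensional 𝕜 X] [FiniteDimensional 𝕜 Y]
    (hX : X ≠ ⊥) (hXY : Module.finrank 𝕜 X ≤ Module.finrank 𝕜 Y)
    (hinv : ∀ x ∈ X, A x ∈ X) (htop : RayleighRitz.IsTopOfSpectrum A X)
    (lamX lamY θ : Fin (Module.finrank 𝕜 X) → ℝ) (lamMin : ℝ)
    (hlamX : lamX = RayleighRitz.ritzValues hA X)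
    (hlamY : lamY = fun i => RayleighRitz.ritzValues hA Y (Fin.castLE hXY i))
    (hθ : θ = RayleighRitz.angles X Y)
    (hlamMin : lamMin = RayleighRitz.minRitzValue hA (X ⊔ Y)) :
    ((∀ i, 0 ≤ lamX i - lamY i) ∧
      RayleighRitz.WeakMajorizedBy (fun i => lamX i - lamY i)
        (fun i => (lamX i - lamMin) * Real.sin (θ i) ^ 2)) ∧
    (∀ i, lamX i - lamY i ≤ (lamX i - lamMin) * ⨆ j, Real.sin (θ j) ^ 2) ∧
    ((∀ i, θ i < Real.pi / 2) → (∀ i, lamMin < lamX i) →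
      (∀ i, lamMin < lamY i) ∧
      ((∀ i, 0 ≤ Real.log ((lamX i - lamMin) / (lamY i - lamMin))) ∧
        RayleighRitz.WeakMajorizedBy
          (fun i => Real.log ((lamX i - lamMin) / (lamY i - lamMin)))
          (fun i => Real.log (1 + Real.tan (θ i) ^ 2))) ∧
      ((∀ i, 0 ≤ (lamX i - lamY i) / (lamY i - lamMin)) ∧
        RayleighRitz.WeakMajorizedBy
          (fun i => (lamX i - lamY i) / (lamY i - lamMin))
          (fun i => Real.tan (θ i) ^ 2))) := by
  have hc : ∀ x ∈ X ⊔ Y, lamMin * ‖x‖ ^ 2 ≤ RCLike.re (inner 𝕜 (A x) x) := fun x hx => by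
    rw [hlamMin]
    exact minRitzValue_mul_le hA hx
  have hYX : ∀ i, lamY i ≤ lamX i := fun i => by
    rw [hlamX, hlamY]
    exact ritzValues_le_of_isTopOfSpectrum hA X Y hXY hinv htop i
  have hXmin : ∀ i, lamMin ≤ lamX i := fun i => by
    rw [hlamX]
    exact le_ritzValues hA X (fun x hx => hc x (Submodule.mem_sup_left hx)) i
  have hanti : Antitone fun i => lamX i - lamMin := fun i j hij =>
    sub_le_sub_right (by rw [hlamX]; exact ritzValues_antitone hA X hij) lamMin
  -- `R` is the square root of `(P_X A)|_X - lamMin` and `C = (P_X P_Y)|_X`.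
  have hTX := diagonalIn_ritzValues hA X
  rw [← hlamX] at hTX
  set u := (compression_isSymmetric hA X).eigenvectorBasis rfl
  obtain ⟨R, hRu⟩ := exists_diagonalIn u fun i => Real.sqrt (lamX i - lamMin)
  have hR := hRu.isSymmetric
  have hB : DiagonalIn (R ∘ₗ R) u fun i => lamX i - lamMin := by
    simpa only [Real.mul_self_sqrt (sub_nonneg.2 (hXmin _))] using hRu.comp hRu
  have hBA : R ∘ₗ R = (compression A X : X →ₗ[𝕜] X) - (lamMin : 𝕜) • 1 := by
    refine hB.ext ?_
    simpa only [mul_one] using hTX.sub ((DiagonalIn.one (u := u)).smul lamMin)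
  have hC := (diagonalIn_ritzValues (isSelfAdjoint_starProjection Y) X).reindex Fin.revPerm
  set C : X →ₗ[𝕜] X := (compression Y.starProjection X : X →ₗ[𝕜] X) with hCdef
  change DiagonalIn C _ (cosSq X Y) at hC
  have hγ := cosSq_monotone X Y
  have hMs : (R ∘ₗ C ∘ₗ R).IsSymmetric := fun x y => by
    simp only [LinearMap.comp_apply]
    rw [hR, hC.isSymmetric, hR]
  have hM := hMs.diagonalIn rfl
  have hν := hMs.eigenvalues_antitone rfl
  set ν := hMs.eigenvalues rfl
  have hνY : ∀ i, ν i ≤ lamY i - lamMin := fun i => by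
    rw [hlamY]
    exact le_ritzValues_sub hA X Y hXY hinv hc hR hBA hM hν i
  subst hθ
  refine ⟨⟨fun i => sub_nonneg.2 (hYX i), ?_⟩, fun i => ?_, fun hθlt hXlt => ?_⟩
  · simp only [sin_sq_angles]
    refine weakMajorizedBy_of_forall_sum_le (fun i j hij => ?_) fun S => ?_
    · exact mul_le_mul (hanti hij) (sub_le_sub_left (hγ hij) 1)
        (sub_nonneg.2 (cosSq_le_one X Y j)) (sub_nonneg.2 (hXmin i))
    · refine le_trans (Finset.sum_le_sum fun i _ => ?_)
        (sum_sub_eigenvalues_congruence_le hR hB hC hM hanti hγ hν (cosSq_le_one X Y) S)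
      linarith [hνY i]
  · have hp : 0 < Module.finrank 𝕜 X := (Nat.zero_le _).trans_lt i.isLt
    have h1 := mul_le_eigenvalues_congruence hR hB hC hM hanti hν
      (cosSq_nonneg X Y ⟨0, hp⟩) (fun j => hγ (by rw [Fin.le_def]; exact Nat.zero_le _)) i
    have h2 : Real.sin (angles X Y ⟨0, hp⟩) ^ 2 ≤ ⨆ j, Real.sin (angles X Y j) ^ 2 :=
      le_ciSup (f := fun j => Real.sin (angles X Y j) ^ 2) (Set.finite_range _).bddAbove _
    rw [sin_sq_angles] at h2
    nlinarith [hνY i, mul_le_mul_of_nonneg_left h2 (sub_nonneg.2 (hXmin i))]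
  · have hγ0 : ∀ i, 0 < cosSq X Y i := fun i => cosSq_pos_of_angles_lt X Y (hθlt i)
    have hX0 : ∀ i, 0 < lamX i - lamMin := fun i => sub_pos.2 (hXlt i)
    have hν0 : ∀ i, 0 < ν i := fun i => by
      have hp : 0 < Module.finrank 𝕜 X := (Nat.zero_le _).trans_lt i.isLt
      exact lt_of_lt_of_le (mul_pos (hγ0 ⟨0, hp⟩) (hX0 i))
        (mul_le_eigenvalues_congruence hR hB hC hM hanti hν
          (cosSq_nonneg X Y _) (fun j => hγ (by rw [Fin.le_def]; exact Nat.zero_le _)) i)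
    have hY0 : ∀ i, 0 < lamY i - lamMin := fun i => (hν0 i).trans_le (hνY i)
    have hlog : WeakMajorizedBy (fun i => Real.log ((lamX i - lamMin) / (lamY i - lamMin)))
        (fun i => Real.log (1 + Real.tan (angles X Y i) ^ 2)) := by
      simp only [one_add_tan_sq_angles X Y (hθlt _), Real.log_inv]
      refine weakMajorizedBy_of_forall_sum_le
        (fun i j hij => neg_le_neg (Real.log_le_log (hγ0 i) (hγ hij))) fun S => ?_
      refine le_trans (Finset.sum_le_sum fun i _ => ?_)
        (sum_log_sub_eigenvalues_congruence_le hR hB hC hM hanti hγ hν hX0 hγ0 S)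
      rw [Real.log_div (hX0 i).ne' (hY0 i).ne']
      exact sub_le_sub_left (Real.log_le_log (hν0 i) (hνY i)) _
    refine ⟨fun i => sub_pos.1 (hY0 i), ⟨fun i => Real.log_nonneg ?_, hlog⟩,
      fun i => div_nonneg (sub_nonneg.2 (hYX i)) (hY0 i).le, ?_⟩
    · rw [one_le_div (hY0 i)]
      exact sub_le_sub_right (hYX i) _
    · convert! hlog.exp_sub_one using 2 with i i
      · rw [Real.exp_log (div_pos (hX0 i) (hY0 i)), div_sub_one (hY0 i).ne',
          sub_sub_sub_cancel_right]
      · rw [Real.exp_log (by positivity), add_sub_cancel_left]
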